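/- Let $\beta$, $b=(b_1,b_2,\dots)$ and $x_1,\dots,x_n$ be indeterminates, and work in the field of fractions of $\mathbb Z[\beta,b_1,b_2,\dots,x_1,\dots,x_n]$. Put $$x\oplus y=x+y+\beta xy,\qquad x\ominus y=\frac{x-y}{1+\beta y},$$ $$[x|b]^k=(x\oplus b_1)\cdots(x\oplus b_k)\quad(k\ge 0),$$ $$[[x|b]]^k=(x\oplus x)(x\oplus b_1)\cdots(x\oplus b_{k-1})\quad(k\ge 1),\qquad [[x|b]]^0=1.$$ For a strict partition $\lambda=(\lambda_1>\dots>\lambda_r>0)$ of length $r\le n$ define $$GP_\lambda(x_1,\dots,x_n|b)=\frac1{(n-r)!}\sum_{w\in S_n}w\Bigl[\prod_{i=1}^r[x_i|b]^{\lambda_i}\prod_{i=1}^r\prod_{j=i+1}^n\frac{x_i\oplus x_j}{x_i\ominus x_j}\Bigr],$$ $$GQ_\lambda(x_1,\dots,x_n|b)=\frac1{(n-r)!}\sum_{w\in S_n}w\Bigl[\prod_{i=1}^r[[x_i|b]]^{\lambda_i}\prod_{i=1}^r\prod_{j=i+1}^n\frac{x_i\oplus x_j}{x_i\ominus x_j}\Bigr],$$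 where $w\in S_n$ replaces each $x_i$ by $x_{w(i)}$. Let $m=r$ if $n-r$ is even and $m=r+1$ if $n-r$ is odd, and set $\lambda_{r+1}=0$. Let $A_0(x_1,\dots,x_n)$ be the skew-symmetric $n\times n$ matrix with $(i,j)$ entry $(x_i-x_j)/(x_i\oplus x_j)$ (with zero diagonal, also when a variable is specialised to $0$), let $B_\lambda$ be the $n\times m$ matrix with $(i,j)$ entry $[[x_i|b]]^{\lambda_{m-j+1}}(1+\beta x_i)^{-j}$, and let $$A_\lambda(x_1,\dots,x_n|b)=\begin{pmatrix}A_0(x_1,\dots,x_n)&B_\lambda\\-{}^tB_\lambda&0\end{pmatrix},$$ a skew-symmetric $(n+m)\times(n+m)$ matrix. Put $\mathrm{Pf}_0(x_1,\dots,x_n)=\mathrm{Pf}\,A_0(x_1,\dots,x_n)$ if $n$ is even and $\mathrm{Pf}_0(x_1,\dots,x_n)=\mathrm{Pf}\,A_0(x_1,\dots,x_n,0)$ if $n$ is odd, where $\mathrm{Pf}$ is the Pfaffian, normalised by $\mathrm{Pf}\begin{pmatrix}0&a\\-a&0\end{pmatrix}=a$. Then $\mathrm{Pf}_0(x_1,\dots,x_n)\neq0$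 and $$GQ_\lambda(x_1,\dots,x_n|b)=\prod_{i=1}^n(1+\beta x_i)^m\;\frac{\mathrm{Pf}\,A_\lambda(x_1,\dots,x_n|b)}{\mathrm{Pf}_0(x_1,\dots,x_n)}.$$ Moreover, $GP_\lambda(x_1,\dots,x_n|b)$ is given by the same formula when $[x_i|b]^k$ is used instead of $[[x_i|b]]^k$ in the definition of $B_\lambda$. -/

import Mathlib

open scoped BigOperators

/-- A strict partition `λ₁ > λ₂ > ⋯ > λ_r > 0`; `parts i` is the part `λ_{i+1}`. -/
structure StrictPartition where
  /-- the length `r` -/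
  length : ℕ
  /-- the parts -/
  parts : Fin length → ℕ
  strictAnti : StrictAnti parts
  pos : ∀ i, 0 < parts i

/-- The parts of a strict partition, extended by zero: `lam.part i` is `λ_{i+1}` for `i < r`
and `0` for `i ≥ r`. -/
def StrictPartition.part (lam : StrictPartition) (i : ℕ) : ℕ :=
  if h : i < lam.length then lam.parts ⟨i, h⟩ else 0

namespace KTheoretic

noncomputable section

/-- `x ⊕ y = x + y + β x y`. -/
def oplus {K : Type*} [Field K] (β x y : K) : K := x + y + β * x * y

/-- `x ⊖ y = (x - y) / (1 + β y)`. -/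
def ominus {K : Type*} [Field K] (β x y : K) : K := (x - y) / (1 + β * y)

/-- `[x|b]^k = (x ⊕ b₁) ⋯ (x ⊕ b_k)`, the parameter `b_{i+1}` being `b i`. -/
def facPow {K : Type*} [Field K] (β : K) (b : ℕ → K) (x : K) (k : ℕ) : K :=
  ∏ i ∈ Finset.range k, oplus β x (b i)

/-- `[[x|b]]^k = (x ⊕ x) (x ⊕ b₁) ⋯ (x ⊕ b_{k-1})` for `k ≥ 1`, and `[[x|b]]^0 = 1`. -/
def dblFacPow {K : Type*} [Field K] (β : K) (b : ℕ → K) (x : K) : ℕ → K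
  | 0 => 1
  | k + 1 => oplus β x x * ∏ i ∈ Finset.range k, oplus β x (b i)

/-- The Hall-Littlewood type sum
`1/(n-r)! ∑_{w ∈ S_n} w [ ∏_{i ≤ r} p(x_i, λ_i) ∏_{i ≤ r} ∏_{i < j ≤ n} (x_i ⊕ x_j)/(x_i ⊖ x_j) ]`
attached to a strict partition of length `r ≤ n` and a family of deformed powers
`p(x, k)`, where `w` replaces `x_i` by `x_{w(i)}`. -/
def hallLittlewoodSum {K : Type*} [Field K] [CharZero K] (β : K) (p : K → ℕ → K) {n : ℕ}
    (x : Fin n → K) (lam : StrictPartition) (hr : lam.length ≤ n) : K :=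
  ((n - lam.length).factorial : K)⁻¹ *
    ∑ w : Equiv.Perm (Fin n),
      (∏ i : Fin lam.length, p (x (w (Fin.castLE hr i))) (lam.parts i)) *
      ∏ i : Fin lam.length, ∏ j ∈ Finset.Ioi (Fin.castLE hr i),
        oplus β (x (w (Fin.castLE hr i))) (x (w j)) /
          ominus β (x (w (Fin.castLE hr i))) (x (w j))

/-- `GP_λ(x₁, …, x_n | b)`. -/
def GP {K : Type*} [Field K] [CharZero K] (β : K) (b : ℕ → K) {n : ℕ}
    (x : Fin n → K) (lam : StrictPartition) (hr : lam.length ≤ n) : K :=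
  hallLittlewoodSum β (facPow β b) x lam hr

/-- `GQ_λ(x₁, …, x_n | b)`. -/
def GQ {K : Type*} [Field K] [CharZero K] (β : K) (b : ℕ → K) {n : ℕ}
    (x : Fin n → K) (lam : StrictPartition) (hr : lam.length ≤ n) : K :=
  hallLittlewoodSum β (dblFacPow β b) x lam hr

/-- The Pfaffian of a skew-symmetric `N × N` matrix over a field of characteristic zero:
`1/(2^k k!) ∑_{σ ∈ S_{2k}} sgn(σ) ∏_{i=1}^k A_{σ(2i-1), σ(2i)}` for `N = 2k`; it is `0` for
odd `N`. -/
def pfaffian {K : Type*} [Field K] [CharZero K] {N : ℕ} (A : Matrix (Fin N) (Fin N) K) : K :=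
  if Even N then
    ((2 : K) ^ (N / 2) * ((N / 2).factorial : K))⁻¹ *
      ∑ σ : Equiv.Perm (Fin N), ((Equiv.Perm.sign σ : ℤ) : K) *
        ∏ i : Fin (N / 2),
          A (σ ⟨2 * (i : ℕ), by have := i.isLt; omega⟩)
            (σ ⟨2 * (i : ℕ) + 1, by have := i.isLt; omega⟩)
  else 0

/-- The skew-symmetric matrix `A₀(x₁, …, x_n)` with entries `(x_i - x_j)/(x_i ⊕ x_j)`. The
diagonal is `0`, also at a variable specialised to `0`. -/
def matA0 {K : Type*} [Field K] (β : K) {n : ℕ} (x : Fin n → K) : Matrix (Fin n) (Fin n) K :=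
  Matrix.of fun i j => (x i - x j) / oplus β (x i) (x j)

/-- The number `m`: `m = r` if `n - r` is even and `m = r + 1` if `n - r` is odd (`r ≤ n`). -/
def nimmoSize (n r : ℕ) : ℕ := if Even (n - r) then r else r + 1

/-- The `n × m` matrix whose `(i, j)` entry, `1 ≤ i ≤ n`, `1 ≤ j ≤ m`, is
`p(x_i, λ_{m-j+1}) (1 + β x_i)^{-j}`. Here `j : Fin m` stands for `j + 1`, and `Fin.rev j` for
`m - j`, that is, for the part `λ_{m-j}`. -/
def matB {K : Type*} [Field K] (β : K) (p : K → ℕ → K) {n : ℕ} (x : Fin n → K)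
    (lam : StrictPartition) (m : ℕ) : Matrix (Fin n) (Fin m) K :=
  Matrix.of fun i j =>
    p (x i) (lam.part (Fin.rev j : ℕ)) * (1 + β * x i) ^ (-((j : ℤ) + 1))

/-- The skew-symmetric `(n + m) × (n + m)` block matrix `(A₀ B; -Bᵗ 0)`, for
`m = nimmoSize n r`. -/
def matA {K : Type*} [Field K] (β : K) (p : K → ℕ → K) {n : ℕ} (x : Fin n → K)
    (lam : StrictPartition) :
    Matrix (Fin (n + nimmoSize n lam.length)) (Fin (n + nimmoSize n lam.length)) K :=
  (Matrix.fromBlocks (matA0 β x) (matB β p x lam (nimmoSize n lam.length))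
    (-(matB β p x lam (nimmoSize n lam.length)).transpose) 0).submatrix
      finSumFinEquiv.symm finSumFinEquiv.symm

/-- `Pf₀(x₁, …, x_n)`: the Pfaffian of `A₀(x₁, …, x_n)` if `n` is even, that of
`A₀(x₁, …, x_n, 0)` if `n` is odd. -/
def pf0 {K : Type*} [Field K] [CharZero K] (β : K) {n : ℕ} (x : Fin n → K) : K :=
  if Even n then pfaffian (matA0 β x)
  else pfaffian (matA0 β (Fin.snoc (α := fun _ => K) x 0 : Fin (n + 1) → K))

/-- The indeterminates `β`, `b₁, b₂, …` (`b i` stands for `b_{i+1}`) and `x₁, …, x_n`. -/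
inductive Var (n : ℕ) : Type
  | beta : Var n
  | b : ℕ → Var n
  | x : Fin n → Var n

/-- The field of rational functions in all the indeterminates, the fraction field of
`ℤ[β, b₁, b₂, …, x₁, …, x_n]`. -/
abbrev RatFun (n : ℕ) : Type := FractionRing (MvPolynomial (Var n) ℤ)

/-- An indeterminate, as a rational function. -/
def ind {n : ℕ} (v : Var n) : RatFun n :=
  algebraMap (MvPolynomial (Var n) ℤ) (RatFun n) (MvPolynomial.X v)

end

end KTheoretic

/-! Write `D(x)` for the product of `(x_i - x_j)/(x_i ⊕ x_j)` over `i < j`. Both sides, once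
multiplied by `D(x)`, become the same signed sum over permutations.

Since `D` is alternating, in the summand of the Hall-Littlewood sum attached to `w` it can be
replaced by `sgn(w) D(x_w)`. Its factors with `i ≤ r` cancel the quotients `(x_i ⊕ x_j)/(x_i ⊖ x_j)`
up to powers of `1 + β x`. What remains is `D` of the last `n - r` permuted variables
(`hallLittlewoodSum_mul_ltProd`).

On the other side, expanding `Pf A_λ` along the columns carrying the positive parts, one at a time,
gives a signed sum over `w` of products of entries of `B_λ` (`factorial_mul_pfaffian_append`). Each
is multiplied by a Pfaffian in the remaining `n - r` variables, bordered by one column `1/(1 + β x)`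
when `n - r` is odd. Schur's Pfaffian evaluates it as `D` times powers of `1 + β x`, and the powers
match (`prod_weights`).

Schur's formula for `(t_i - t_j)/(t_i + t_j)` follows by expansion along the last column and
Lagrange interpolation. The substitution `t = x/(2 + β x)` carries it over to `⊕`. A variable equal
to `0` has `t = 0`, which gives `Pf₀` for odd `n`; a variable at infinity has `t = 1/β`, which gives
the border column up to sign. Of the deformed powers only `p(y, 0) = 1` is used, so `GQ` and `GP`
are treated together. -/

namespace KTheoretic

open Equiv Equiv.Perm

/-! ### Pfaffians as sums over permutations, and their row and column expansions. -/

section Pfaffian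

variable {K : Type*} [Field K]

/-- The summand of the Pfaffian of a `2k × 2k` matrix attached to a permutation. -/
def pfTerm {N k : ℕ} (h : N = 2 * k) (A : Matrix (Fin N) (Fin N) K) (σ : Perm (Fin N)) : K :=
  ((sign σ : ℤ) : K) * ∏ i : Fin k,
    A (σ ⟨2 * (i : ℕ), by have := i.isLt; omega⟩) (σ ⟨2 * (i : ℕ) + 1, by have := i.isLt; omega⟩)

theorem pfaffian_eq_sum [CharZero K] {N k : ℕ} (h : N = 2 * k) (A : Matrix (Fin N) (Fin N) K) :
    pfaffian A = ((2 : K) ^ k * (k.factorial : K))⁻¹ * ∑ σ : Perm (Fin N), pfTerm h A σ := by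
  have hk : N / 2 = k := by omega
  rw [pfaffian, if_pos ⟨k, by omega⟩]
  refine congrArg₂ (· * ·) (by rw [hk]) (Finset.sum_congr rfl fun σ _ => ?_)
  refine congrArg₂ (· * ·) rfl ?_
  exact Fintype.prod_equiv (finCongr hk) _ _ fun i => rfl

theorem pfaffian_submatrix_perm [CharZero K] {N : ℕ} (A : Matrix (Fin N) (Fin N) K) (τ : Perm (Fin N)) :
    pfaffian (A.submatrix τ τ) = ((sign τ : ℤ) : K) * pfaffian A := by
  by_cases hN : Even N
  · obtain ⟨k, hk⟩ := hN
    have h : N = 2 * k := by omega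
    rw [pfaffian_eq_sum h, pfaffian_eq_sum h, mul_left_comm, Finset.mul_sum _ _ ((sign τ : ℤ) : K)]
    congr 1
    refine Fintype.sum_equiv (Equiv.mulLeft τ) _ _ fun σ => ?_
    rw [pfTerm, pfTerm, ← mul_assoc, Equiv.coe_mulLeft, Perm.sign_mul]
    congr 1
    rcases Int.units_eq_one_or (sign τ) with h | h <;> simp [h]
  · simp [pfaffian, hN]

/-- The sign of the transposition cancels the sign produced by skew symmetry in the first factor;
the other factors are untouched. -/
theorem pfTerm_mul_swap_zero_one {N k : ℕ} (h : N = 2 * (k + 1)) {A : Matrix (Fin N) (Fin N) K}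
    (hA : ∀ i j, A i j = -A j i) (σ : Perm (Fin N)) :
    pfTerm h A (σ * swap ⟨0, by omega⟩ ⟨1, by omega⟩) = pfTerm h A σ := by
  have hs : ∀ j : Fin k, swap (⟨0, by omega⟩ : Fin N) ⟨1, by omega⟩
      ⟨2 * ((j.succ : Fin (k + 1)) : ℕ), by have := j.isLt; simp; omega⟩ =
      ⟨2 * ((j.succ : Fin (k + 1)) : ℕ), by have := j.isLt; simp; omega⟩ := fun j =>
    swap_apply_of_ne_of_ne (by simp [Fin.ext_iff]) (by simp only [ne_eq, Fin.ext_iff]; omega)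
  have hs' : ∀ j : Fin k, swap (⟨0, by omega⟩ : Fin N) ⟨1, by omega⟩
      ⟨2 * ((j.succ : Fin (k + 1)) : ℕ) + 1, by have := j.isLt; simp; omega⟩ =
      ⟨2 * ((j.succ : Fin (k + 1)) : ℕ) + 1, by have := j.isLt; simp; omega⟩ := fun j =>
    swap_apply_of_ne_of_ne (by simp [Fin.ext_iff]) (by simp [Fin.ext_iff])
  have h0 : swap (⟨0, by omega⟩ : Fin N) ⟨1, by omega⟩ ⟨2 * ((0 : Fin (k + 1)) : ℕ), by simp; omega⟩
      = ⟨2 * ((0 : Fin (k + 1)) : ℕ) + 1, by simp; omega⟩ := swap_apply_left _ _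
  have h1 : swap (⟨0, by omega⟩ : Fin N) ⟨1, by omega⟩
      ⟨2 * ((0 : Fin (k + 1)) : ℕ) + 1, by simp; omega⟩
      = ⟨2 * ((0 : Fin (k + 1)) : ℕ), by simp; omega⟩ := swap_apply_right _ _
  rw [pfTerm, pfTerm, Fin.prod_univ_succ, Fin.prod_univ_succ, Perm.sign_mul,
    sign_swap (by simp [Fin.ext_iff])]
  simp only [Perm.mul_apply, hs, hs', h0, h1]
  rw [hA (σ _) (σ _)]
  push_cast
  ring

/-- The permutation exchanging the pair `(0, 1)` with the pair `(2i, 2i + 1)`. -/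
def pairSwap {N k : ℕ} (h : N = 2 * (k + 1)) (i : Fin (k + 1)) : Perm (Fin N) :=
  swap ⟨0, by omega⟩ ⟨2 * (i : ℕ), by have := i.isLt; omega⟩ *
    swap ⟨1, by omega⟩ ⟨2 * (i : ℕ) + 1, by have := i.isLt; omega⟩

theorem pairSwap_even {N k : ℕ} (h : N = 2 * (k + 1)) (i j : Fin (k + 1)) :
    pairSwap h i ⟨2 * (j : ℕ), by have := j.isLt; omega⟩ =
      ⟨2 * (swap 0 i j : ℕ), by have := (swap 0 i j).isLt; omega⟩ := by
  simp only [pairSwap, Perm.mul_apply, swap_apply_def, Fin.ext_iff, Fin.val_zero]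
  split_ifs <;> simp_all <;> omega

theorem pairSwap_odd {N k : ℕ} (h : N = 2 * (k + 1)) (i j : Fin (k + 1)) :
    pairSwap h i ⟨2 * (j : ℕ) + 1, by have := j.isLt; omega⟩ =
      ⟨2 * (swap 0 i j : ℕ) + 1, by have := (swap 0 i j).isLt; omega⟩ := by
  simp only [pairSwap, Perm.mul_apply, swap_apply_def, Fin.ext_iff, Fin.val_zero]
  split_ifs <;> simp_all <;> omega

theorem sign_pairSwap {N k : ℕ} (h : N = 2 * (k + 1)) (i : Fin (k + 1)) :
    sign (pairSwap h i) = 1 := by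
  rw [pairSwap, Perm.sign_mul, sign_swap', sign_swap']
  by_cases hi : i = 0
  · simp [hi]
  · have : (i : ℕ) ≠ 0 := fun h => hi (Fin.ext h)
    rw [if_neg (by simp only [Fin.mk.injEq]; omega), if_neg (by simp only [Fin.mk.injEq]; omega)]
    simp

/-- A product of two transpositions, or the identity, is even, and here it only permutes the factors
of the product. -/
theorem pfTerm_mul_pairSwap {N k : ℕ} (h : N = 2 * (k + 1)) (A : Matrix (Fin N) (Fin N) K)
    (i : Fin (k + 1)) (σ : Perm (Fin N)) :
    pfTerm h A (σ * pairSwap h i) = pfTerm h A σ := by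
  rw [pfTerm, pfTerm, Perm.sign_mul, sign_pairSwap, mul_one]
  congr 1
  refine Fintype.prod_equiv (swap 0 i) _ _ fun j => ?_
  rw [Perm.mul_apply, Perm.mul_apply, pairSwap_even, pairSwap_odd]

/-- The permutations that preserve the pairing of positions act transitively on positions: exchange
pairs to reach an even position, and also flip the first pair to reach an odd one. -/
theorem exists_pfTerm_stabilizer {N k : ℕ} (h : N = 2 * (k + 1)) {A : Matrix (Fin N) (Fin N) K}
    (hA : ∀ i j, A i j = -A j i) (p : Fin N) :
    ∃ τ : Perm (Fin N), τ ⟨0, by omega⟩ = p ∧ ∀ σ, pfTerm h A (σ * τ) = pfTerm h A σ := by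
  have hp := p.isLt
  rcases Nat.even_or_odd' (p : ℕ) with ⟨c, hc | hc⟩
  · refine ⟨pairSwap h ⟨c, by omega⟩, ?_, pfTerm_mul_pairSwap h A _⟩
    have := pairSwap_even h ⟨c, by omega⟩ 0
    simp only [swap_apply_left] at this
    exact this.trans (Fin.ext hc.symm)
  · refine ⟨pairSwap h ⟨c, by omega⟩ * swap ⟨0, by omega⟩ ⟨1, by omega⟩, ?_, fun σ => ?_⟩
    · rw [Perm.mul_apply, swap_apply_left]
      have := pairSwap_odd h ⟨c, by omega⟩ 0
      simp only [swap_apply_left] at this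
      exact this.trans (Fin.ext hc.symm)
    · rw [← mul_assoc, pfTerm_mul_swap_zero_one h hA, pfTerm_mul_pairSwap]

/-- Sort the permutations by the position `p` that they send to `0`. By transitivity of the
stabilizer all `N` classes contribute equally. -/
theorem sum_pfTerm_eq {N k : ℕ} (h : N = 2 * (k + 1)) {A : Matrix (Fin N) (Fin N) K}
    (hA : ∀ i j, A i j = -A j i) :
    ∑ σ : Perm (Fin N), pfTerm h A σ =
      N * ∑ σ : Perm (Fin N), if σ ⟨0, by omega⟩ = ⟨0, by omega⟩ then pfTerm h A σ else 0 := by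
  have h1 : ∀ σ : Perm (Fin N), pfTerm h A σ =
      ∑ p : Fin N, if σ p = ⟨0, by omega⟩ then pfTerm h A σ else 0 := fun σ => by
    simp only [← Equiv.eq_symm_apply, Finset.sum_ite_eq', Finset.mem_univ, if_true]
  rw [Finset.sum_congr rfl fun σ _ => h1 σ, Finset.sum_comm]
  refine (Finset.sum_eq_card_nsmul fun p _ => ?_).trans
    (by rw [Finset.card_univ, Fintype.card_fin, nsmul_eq_mul])
  obtain ⟨τ, hτ, hτ'⟩ := exists_pfTerm_stabilizer h hA p
  refine Fintype.sum_equiv (Equiv.mulRight τ) _ _ fun σ => ?_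
  rw [Equiv.coe_mulRight, hτ', Perm.mul_apply, hτ]

/-- Expansion of the Pfaffian of a skew-symmetric matrix along its first row. -/
theorem pfaffian_expand_row [CharZero K] {a : ℕ} (ha : Even a) {A : Matrix (Fin (a + 2)) (Fin (a + 2)) K}
    (hA : ∀ i j, A i j = -A j i) :
    pfaffian A = ∑ d : Fin (a + 1), (if d = 0 then 1 else -1) * A 0 d.succ *
      pfaffian (A.submatrix (fun i : Fin a => (swap 0 d i.succ).succ)
        (fun i : Fin a => (swap 0 d i.succ).succ)) := by
  obtain ⟨k, hk⟩ := ha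
  have h' : a = 2 * k := by omega
  have h : a + 2 = 2 * (k + 1) := by omega
  have key : (∑ σ : Perm (Fin (a + 2)),
      if σ ⟨0, by omega⟩ = ⟨0, by omega⟩ then pfTerm h A σ else 0) =
      ∑ d : Fin (a + 1), (if d = 0 then 1 else -1) * A 0 d.succ * ∑ σ : Perm (Fin a),
        pfTerm h' (A.submatrix (fun i : Fin a => (swap 0 d i.succ).succ)
        (fun i : Fin a => (swap 0 d i.succ).succ)) σ := by
    -- The first use of `decomposeFin` isolates the value at `0`, which has to be `0`. The second
    -- isolates the value `d.succ` at `1`. The minor then appears with its rows in the order of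
    -- `swap 0 d`, so its sign is that of a transposition and not `(-1)^d`.
    rw [← Equiv.sum_comp decomposeFin.symm, Fintype.sum_prod_type, Finset.sum_eq_single 0]
    · rw [← Equiv.sum_comp decomposeFin.symm, Fintype.sum_prod_type]
      refine Finset.sum_congr rfl fun d _ => ?_
      rw [Finset.mul_sum]
      refine Finset.sum_congr rfl fun e _ => ?_
      refine (if_pos (decomposeFin_symm_apply_zero _ _)).trans ?_
      rw [pfTerm, pfTerm, Fin.prod_univ_succ]
      have e0 : decomposeFin.symm ((0 : Fin (a + 2)), decomposeFin.symm (d, e))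
          ⟨2 * ((0 : Fin (k + 1)) : ℕ), by simp⟩ = 0 := decomposeFin_symm_apply_zero _ _
      have e1 : decomposeFin.symm ((0 : Fin (a + 2)), decomposeFin.symm (d, e))
          ⟨2 * ((0 : Fin (k + 1)) : ℕ) + 1, by simp⟩ = d.succ := by
        refine (decomposeFin_symm_apply_succ _ _ 0).trans ?_
        simp
      have e2 : ∀ i : Fin a, decomposeFin.symm ((0 : Fin (a + 2)), decomposeFin.symm (d, e))
          i.succ.succ = (swap 0 d (e i).succ).succ := fun i => by
        rw [decomposeFin_symm_apply_succ, decomposeFin_symm_apply_succ]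
        simp
      rw [e0, e1, decomposeFin.symm_sign, decomposeFin.symm_sign, if_pos rfl, one_mul]
      have : (((if d = 0 then 1 else -1 : ℤˣ) * sign e : ℤˣ) : ℤ) =
          (if d = 0 then 1 else -1) * (sign e : ℤ) := by split_ifs <;> simp
      rw [this]
      push_cast
      simp only [mul_assoc]
      congr 1
      rw [mul_left_comm]
      congr 2
      refine Finset.prod_congr rfl fun i _ => ?_
      have hi := i.isLt
      exact congrArg₂ A (e2 ⟨2 * (i : ℕ), by omega⟩) (e2 ⟨2 * (i : ℕ) + 1, by omega⟩)
    · intro p _ hp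
      refine Finset.sum_eq_zero fun e _ => if_neg ?_
      intro h0
      exact hp ((decomposeFin_symm_apply_zero p e).symm.trans h0)
    · simp
  rw [pfaffian_eq_sum h, sum_pfTerm_eq h hA, key]
  simp only [pfaffian_eq_sum h', Finset.mul_sum]
  refine Finset.sum_congr rfl fun d _ => Finset.sum_congr rfl fun σ _ => ?_
  -- The factor `N = 2 (k + 1)` reduces the normalisation `2^(k+1) (k+1)!` to `2^k k!`.
  have hcast : ((a + 2 : ℕ) : K) = 2 * ((k : K) + 1) := by rw [h]; push_cast; ring
  have hk1 : (k : K) + 1 ≠ 0 := Nat.cast_add_one_ne_zero k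
  have hf : (k.factorial : K) ≠ 0 := Nat.cast_ne_zero.2 k.factorial_ne_zero
  rw [hcast, Nat.factorial_succ, pow_succ]
  push_cast
  field_simp

/-- Expansion of the Pfaffian of a skew-symmetric matrix along its last column. -/
theorem pfaffian_expand_col [CharZero K] {a : ℕ} (ha : Even a) {A : Matrix (Fin (a + 2)) (Fin (a + 2)) K}
    (hA : ∀ i j, A i j = -A j i) :
    pfaffian A = ∑ d : Fin (a + 1), (if d = 0 then 1 else -1) * A d.castSucc (Fin.last _) *
      pfaffian (A.submatrix (fun i : Fin a => (swap 0 d i.succ).castSucc)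
        (fun i : Fin a => (swap 0 d i.succ).castSucc)) := by
  have hr := pfaffian_submatrix_perm A (finRotate (a + 2)).symm
  have h0 : (finRotate (a + 2)).symm 0 = Fin.last _ := by
    rw [Equiv.symm_apply_eq, finRotate_last]
  have h1 : ∀ d : Fin (a + 1), (finRotate (a + 2)).symm d.succ = d.castSucc := fun d => by
    rw [Equiv.symm_apply_eq]
    exact (Fin.ext (by simp)).symm
  rw [Perm.sign_symm, sign_finRotate] at hr
  have hs : (((-1 : ℤˣ) ^ (a + 2 - 1) : ℤˣ) : ℤ) = -1 := by
    rw [show a + 2 - 1 = a + 1 from rfl, pow_succ, ha.neg_one_pow]; simp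
  rw [hs] at hr
  -- Rotating an even number of indices has sign `-1`; this is compensated by `A last d = -A d
  -- last`.
  have : pfaffian A = -(((-1 : ℤ) : K) * pfaffian A) := by push_cast; ring
  rw [this, ← hr, pfaffian_expand_row ha (fun i j => by exact hA _ _), ← Finset.sum_neg_distrib]
  refine Finset.sum_congr rfl fun d _ => ?_
  simp only [Matrix.submatrix_apply, Matrix.submatrix_submatrix, Function.comp_def, h0, h1]
  rw [hA]
  ring

end Pfaffian

/-! ### Iterated column expansion of a bordered Pfaffian. -/

section BlockExpansion

variable {K : Type*} [Field K] [CharZero K] {ι : Type*}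

/-- Here `N` is only propositionally `a + 1`, so that the expansion applies to sizes such as `n + 1
+ s + r`. -/
theorem pfaffian_submatrix_expand_col {N a : ℕ} (hN : N = a + 1) (ha : Even a)
    {M : Matrix ι ι K} (hM : ∀ i j, M i j = -M j i) (v : Fin (N + 1) → ι) :
    pfaffian (M.submatrix v v) = ∑ d : Fin N, (if (d : ℕ) = 0 then 1 else -1) *
      M (v d.castSucc) (v (Fin.last _)) *
      pfaffian (M.submatrix
        (fun i : Fin a => v (swap ⟨0, by omega⟩ d ⟨(i : ℕ) + 1, by omega⟩).castSucc)
        (fun i : Fin a => v (swap ⟨0, by omega⟩ d ⟨(i : ℕ) + 1, by omega⟩).castSucc)) := by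
  subst hN
  rw [pfaffian_expand_col ha (fun i j => by exact hM _ _)]
  refine Finset.sum_congr rfl fun d _ => ?_
  simp only [Fin.ext_iff, Fin.val_zero]
  rfl

theorem pfaffian_append_perm {n s : ℕ} (M : Matrix ι ι K) (e : Fin n → ι) (g : Fin s → ι)
    (w : Perm (Fin n)) :
    pfaffian (M.submatrix (Fin.append (e ∘ w) g) (Fin.append (e ∘ w) g)) =
      ((sign w : ℤ) : K) * pfaffian (M.submatrix (Fin.append e g) (Fin.append e g)) := by
  have h := pfaffian_submatrix_perm (M.submatrix (Fin.append e g) (Fin.append e g))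
    (finSumFinEquiv.permCongr (Perm.sumCongr w 1))
  rw [sign_permCongr, sign_sumCongr, Perm.sign_one, mul_one] at h
  rw [← h, Matrix.submatrix_submatrix]
  have : Fin.append (e ∘ w) g =
      Fin.append e g ∘ finSumFinEquiv.permCongr (Perm.sumCongr w 1) := by
    funext i
    refine Fin.addCases (fun i => ?_) (fun i => ?_) i <;> simp [Equiv.permCongr_apply]
  rw [this]

/-- The transposition lies inside the `e` block, so deleting row `d` of `e` leaves the blocks `g`
and `f` in place and the minor is again of bordered shape. -/
theorem append_append_swap {n s r : ℕ} (e : Fin (n + 1) → ι) (g : Fin s → ι) (f : Fin r → ι)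
    (d : Fin (n + 1)) (i : Fin (n + s + r)) :
    Fin.append (Fin.append e g) f (swap ⟨0, by omega⟩ (Fin.castAdd r (Fin.castAdd s d))
      ⟨(i : ℕ) + 1, by omega⟩) =
      Fin.append (Fin.append (fun i => e (swap 0 d i.succ)) g) f i := by
  have h0 : (⟨0, by omega⟩ : Fin (n + 1 + s + r)) = Fin.castAdd r (Fin.castAdd s 0) := rfl
  have hd := d.isLt
  rw [h0]
  refine Fin.addCases (fun i => ?_) (fun i => ?_) i
  · refine Fin.addCases (fun i => ?_) (fun i => ?_) i
    · have : (⟨((Fin.castAdd r (Fin.castAdd s i) : Fin _) : ℕ) + 1, by simp; omega⟩ :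
          Fin (n + 1 + s + r)) = Fin.castAdd r (Fin.castAdd s i.succ) := rfl
      rw [this, Fin.append_left, Fin.append_left,
        ← Function.Injective.map_swap (f := fun j => Fin.castAdd r (Fin.castAdd s j))
          (fun a b h => by simpa [Fin.ext_iff] using h), Fin.append_left, Fin.append_left]
    · have : (⟨((Fin.castAdd r (Fin.natAdd n i) : Fin _) : ℕ) + 1, by simp; omega⟩ :
          Fin (n + 1 + s + r)) = Fin.castAdd r (Fin.natAdd (n + 1) i) := Fin.ext (by simp; omega)
      rw [this, swap_apply_of_ne_of_ne (by simp only [ne_eq, Fin.ext_iff, Fin.val_castAdd, Fin.val_natAdd, Fin.val_zero]; omega)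
        (by simp only [ne_eq, Fin.ext_iff, Fin.val_castAdd, Fin.val_natAdd]; omega)]
      simp
  · have : (⟨((Fin.natAdd (n + s) i : Fin _) : ℕ) + 1, by simp; omega⟩ :
        Fin (n + 1 + s + r)) = Fin.natAdd (n + 1 + s) i := Fin.ext (by simp; omega)
    rw [this, swap_apply_of_ne_of_ne (by simp only [ne_eq, Fin.ext_iff, Fin.val_castAdd, Fin.val_natAdd, Fin.val_zero]; omega)
      (by simp only [ne_eq, Fin.ext_iff, Fin.val_castAdd, Fin.val_natAdd]; omega)]
    simp

/-- Expansion of the Pfaffian of a bordered skew-symmetric matrix, whose rows are indexed by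
`e`, `g` and `f` in this order, when the blocks `(g, f)` and `(f, f)` vanish. -/
theorem factorial_mul_pfaffian_append {M : Matrix ι ι K} (hM : ∀ i j, M i j = -M j i) {s : ℕ}
    (g : Fin s → ι) {r q n : ℕ} (hn : n = r + q) (hq : Even (q + s)) (e : Fin n → ι)
    (f : Fin r → ι) (hgf : ∀ i j, M (g i) (f j) = 0) (hff : ∀ i j, M (f i) (f j) = 0) :
    (q.factorial : K) * pfaffian (M.submatrix (Fin.append (Fin.append e g) f)
        (Fin.append (Fin.append e g) f)) =
      ∑ w : Perm (Fin n), ((sign w : ℤ) : K) *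
        ((∏ i : Fin r, M (e (w ⟨i, by omega⟩)) (f i.rev)) *
        pfaffian (M.submatrix (Fin.append (fun j : Fin q => e (w ⟨r + j, by omega⟩)) g)
          (Fin.append (fun j : Fin q => e (w ⟨r + j, by omega⟩)) g))) := by
  induction r generalizing n with
  | zero =>
    obtain rfl : n = q := by omega
    have h : ∀ w : Perm (Fin n), (fun j : Fin n => e (w ⟨0 + j, by omega⟩)) = e ∘ w := fun w => by
      funext j; simp
    have h2 : Fin.append (Fin.append e g) f = Fin.append e g := by
      rw [Subsingleton.elim f Fin.elim0, Fin.append_elim0]; rfl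
    simp only [h, pfaffian_append_perm, h2, Finset.univ_eq_empty, Finset.prod_empty, one_mul,
      ← mul_assoc]
    -- The two signs of `w` multiply to `1`, so the `q!` permutations of the remaining rows give
    -- equal terms.
    rw [← Finset.sum_mul, Finset.sum_congr rfl (g := fun _ => (1 : K)) fun w _ => by
      rcases Int.units_eq_one_or (sign w) with h | h <;> simp [h]]
    simp [Fintype.card_perm]
  | succ r ih =>
    obtain ⟨n, rfl⟩ : ∃ n', n = n' + 1 := ⟨r + q, by omega⟩
    have hn' : n = r + q := by omega
    set f' : Fin r → ι := fun i => f i.castSucc with hf'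
    set V : Fin (n + 1 + s + (r + 1)) → ι := Fin.append (Fin.append e g) f with hV
    have hv : ∀ d : Fin (n + 1 + s + r), V d.castSucc =
        Fin.append (Fin.append e g) f' d := fun d => by
      refine Fin.addCases (fun i => ?_) (fun i => ?_) d
      · rw [Fin.append_left]
        exact Fin.append_left _ _ i
      · rw [Fin.append_right]
        exact Fin.append_right _ _ i.castSucc
    have hl : V (Fin.last (n + 1 + s + r)) = f (Fin.last r) :=
      Fin.append_right _ _ (Fin.last r)
    have ha : Even (n + s + r) := by
      obtain ⟨c, hc⟩ := hq
      exact ⟨c + r, by omega⟩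
    have hexp := pfaffian_submatrix_expand_col (N := n + 1 + s + r) (a := n + s + r) (by omega) ha
      hM V
    rw [show pfaffian (M.submatrix V V) = _ from hexp]
    simp only [hv, hl]
    -- The last column vanishes in the rows of `g` and `f`; only rows of `e` survive.
    rw [Fin.sum_univ_add, Fin.sum_univ_add]
    simp only [Fin.append_left, Fin.append_right, hgf, hff, hf', mul_zero, zero_mul,
      Finset.sum_const_zero, add_zero]
    -- The row `d` paired with the last column is the value at `0` of the permutation being built.
    -- The columns are consumed from the last one backwards, hence `f i.rev`.
    rw [← Equiv.sum_comp decomposeFin.symm, Fintype.sum_prod_type, Finset.mul_sum]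
    refine Finset.sum_congr rfl fun d _ => ?_
    have hih := ih hn' (fun i => e (swap 0 d i.succ)) f' (fun i j => hgf _ _) (fun i j => hff _ _)
    simp only [append_append_swap]
    rw [mul_left_comm, hih, Finset.mul_sum]
    refine Finset.sum_congr rfl fun w _ => ?_
    have hw : ∀ i : Fin n, decomposeFin.symm (d, w) i.succ = swap 0 d (w i).succ :=
      decomposeFin_symm_apply_succ w d
    have hw' : ∀ j : Fin q, decomposeFin.symm (d, w) ⟨r + 1 + j, by omega⟩ =
        swap 0 d (w ⟨r + j, by omega⟩).succ := fun j => by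
      rw [← hw]
      congr 1
      exact Fin.ext (by simp; omega)
    have h0 : decomposeFin.symm (d, w) ⟨((0 : Fin (r + 1)) : ℕ), by simp⟩ = d :=
      decomposeFin_symm_apply_zero d w
    have h1 : ∀ i : Fin r, decomposeFin.symm (d, w) ⟨(i.succ : ℕ), by simp; omega⟩ =
        swap 0 d (w ⟨i, by omega⟩).succ := fun i => hw ⟨i, by omega⟩
    have hs : ((sign (decomposeFin.symm (d, w)) : ℤ) : K) =
        (if (d : ℕ) = 0 then 1 else -1) * ((sign w : ℤ) : K) := by
      have : d = 0 ↔ (d : ℕ) = 0 := Fin.ext_iff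
      rw [decomposeFin.symm_sign]
      simp only [this]
      split_ifs <;> simp
    rw [Fin.prod_univ_succ, hs]
    simp only [hw', h0, h1, Fin.rev_zero, Fin.rev_succ, Fin.val_castAdd, hf']
    ring

end BlockExpansion

/-! ### The rational identities behind Schur's Pfaffian. -/

section PartialFractions

variable {K : Type*} [Field K]

theorem prod_univ_erase_none {α : Type*} [Fintype α] [DecidableEq α] (f : Option α → K) :
    ∏ j ∈ Finset.univ.erase none, f j = ∏ a, f (some a) := by
  have : (Finset.univ : Finset (Option α)).erase none = Finset.univ.map Function.Embedding.some := by
    ext x; cases x <;> simp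
  rw [this, Finset.prod_map]
  rfl

theorem prod_univ_erase_some {α : Type*} [Fintype α] [DecidableEq α] (f : Option α → K) (a : α) :
    ∏ j ∈ Finset.univ.erase (some a), f j = f none * ∏ b ∈ Finset.univ.erase a, f (some b) := by
  have : (Finset.univ : Finset (Option α)).erase (some a) =
      Finset.insertNone (Finset.univ.erase a) := by
    ext x; cases x <;> simp
  rw [this, Finset.prod_insertNone]

theorem prod_neg_sub_odd {N : ℕ} (hN : Odd N) (f : Fin N → K) : ∏ i, -f i = -∏ i, f i := by
  rw [Finset.prod_neg, Finset.card_univ, Fintype.card_fin, hN.neg_one_pow, neg_one_mul]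

/-- Lagrange interpolation of the monic polynomial `(X - s) ∏ (X + t_j)`, of degree `N + 1`, at the
`N + 2` nodes `0`, `-s`, `t_j`. Comparing leading coefficients gives `1 = 1 - 2 ∏ + 2 ∑`, where `∏`
and `∑` are the two sides of the identity; oddness of `N` makes the contribution of the node `0`
equal to `1`. -/
theorem sum_prod_add_div_sub_of_ne_zero [CharZero K] {N : ℕ} (hN : Odd N) {t : Fin N → K}
    (ht : Function.Injective t) (h0 : ∀ i, t i ≠ 0) {s : K} (hs : ∀ i, t i + s ≠ 0) (hs0 : s ≠ 0) :
    ∑ d, (t d - s) / (t d + s) * ∏ j ∈ Finset.univ.erase d, (t d + t j) / (t d - t j) =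
      ∏ d, (t d - s) / (t d + s) := by
  set P : Polynomial K := (∏ j, (Polynomial.X + Polynomial.C (t j))) *
    (Polynomial.X - Polynomial.C s) with hP
  have hm : (∏ j, (Polynomial.X + Polynomial.C (t j))).Monic :=
    Polynomial.monic_prod_of_monic _ _ fun j _ => Polynomial.monic_X_add_C _
  have hPm : P.Monic := hm.mul (Polynomial.monic_X_sub_C s)
  have hdeg : P.natDegree = N + 1 := by
    rw [hP, hm.natDegree_mul (Polynomial.monic_X_sub_C s), Polynomial.natDegree_X_sub_C,
      Polynomial.natDegree_prod_of_monic _ _ fun j _ => Polynomial.monic_X_add_C _]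
    simp
  let v : Option (Option (Fin N)) → K := fun o => o.elim 0 fun o => o.elim (-s) t
  have hv : Function.Injective v := by
    rintro (_ | _ | i) (_ | _ | j) h
    · rfl
    · exact absurd (neg_eq_zero.1 h.symm) hs0
    · exact absurd h.symm (h0 j)
    · exact absurd (neg_eq_zero.1 h) hs0
    · rfl
    · exact absurd (by rw [show t j = -s from h.symm]; ring) (hs j)
    · exact absurd h (h0 i)
    · exact absurd (by rw [show t i = -s from h]; ring) (hs i)
    · rw [ht h]
  have key := Lagrange.leadingCoeff_eq_sum (s := Finset.univ) (v := v) hv.injOn (P := P) (by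
    rw [Polynomial.degree_eq_natDegree hPm.ne_zero, hdeg]
    simp)
  rw [hPm.leadingCoeff, Fintype.sum_option, Fintype.sum_option] at key
  simp only [prod_univ_erase_none, prod_univ_erase_some, Fintype.prod_option] at key
  simp only [v, Option.elim_none, Option.elim_some, hP, Polynomial.eval_mul, Polynomial.eval_prod,
    Polynomial.eval_add, Polynomial.eval_sub, Polynomial.eval_X, Polynomial.eval_C] at key
  have e1 : ((∏ j, (0 + t j)) * (0 - s)) / ((0 - -s) * ∏ j, (0 - t j)) = 1 := by
    simp only [zero_add, zero_sub, neg_neg, prod_neg_sub_odd hN]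
    have := Finset.prod_ne_zero_iff.2 fun i (_ : i ∈ Finset.univ) => h0 i
    field_simp
  have e2 : ((∏ j, (-s + t j)) * (-s - s)) / ((-s - 0) * ∏ j, (-s - t j)) =
      -2 * ∏ d, (t d - s) / (t d + s) := by
    have e3 : ∏ j, (-s - t j) = -∏ j, (t j + s) := by
      rw [← prod_neg_sub_odd hN]
      exact Finset.prod_congr rfl fun j _ => by ring
    have e4 : ∏ j, (-s + t j) = ∏ j, (t j - s) := Finset.prod_congr rfl fun j _ => by ring
    have := Finset.prod_ne_zero_iff.2 fun i (_ : i ∈ Finset.univ) => hs i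
    rw [e3, e4, Finset.prod_div_distrib, sub_zero]
    field_simp
    ring
  have e5 : ∀ d, ((∏ j, (t d + t j)) * (t d - s)) / ((t d - 0) * ((t d - -s) *
      ∏ j ∈ Finset.univ.erase d, (t d - t j))) = 2 * ((t d - s) / (t d + s) *
        ∏ j ∈ Finset.univ.erase d, (t d + t j) / (t d - t j)) := fun d => by
    have := hs d
    have := h0 d
    have : ∏ j ∈ Finset.univ.erase d, (t d - t j) ≠ 0 := Finset.prod_ne_zero_iff.2 fun j hj =>
      sub_ne_zero.2 fun h => (Finset.ne_of_mem_erase hj) (ht h).symm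
    rw [← Finset.mul_prod_erase _ _ (Finset.mem_univ d), Finset.prod_div_distrib, sub_neg_eq_add,
      sub_zero]
    field_simp
    ring
  rw [e1, e2, Finset.sum_congr rfl fun d _ => e5 d, ← Finset.mul_sum] at key
  have h2 : (2 : K) ≠ 0 := two_ne_zero
  refine mul_left_cancel₀ h2 ?_
  linear_combination -key

/-- The case `s = 0`, where the nodes `0` and `-s` would collide. Interpolating `∏ (X + t_j)` at `0`
and the `t_j` gives `1 = -1 + 2 ∑`. -/
theorem sum_prod_add_div_sub [CharZero K] {N : ℕ} (hN : Odd N) {t : Fin N → K}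
    (ht : Function.Injective t) (h0 : ∀ i, t i ≠ 0) :
    ∑ d, ∏ j ∈ Finset.univ.erase d, (t d + t j) / (t d - t j) = 1 := by
  set P : Polynomial K := ∏ j, (Polynomial.X + Polynomial.C (t j)) with hP
  have hPm : P.Monic :=
    Polynomial.monic_prod_of_monic _ _ fun j _ => Polynomial.monic_X_add_C _
  have hdeg : P.natDegree = N := by
    rw [hP, Polynomial.natDegree_prod_of_monic _ _ fun j _ => Polynomial.monic_X_add_C _]
    simp
  let v : Option (Fin N) → K := fun o => o.elim 0 t
  have hv : Function.Injective v := by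
    rintro (_ | i) (_ | j) h
    · rfl
    · exact absurd h.symm (h0 j)
    · exact absurd h (h0 i)
    · rw [ht h]
  have key := Lagrange.leadingCoeff_eq_sum (s := Finset.univ) (v := v) hv.injOn (P := P) (by
    rw [Polynomial.degree_eq_natDegree hPm.ne_zero, hdeg]
    simp)
  rw [hPm.leadingCoeff, Fintype.sum_option] at key
  simp only [prod_univ_erase_none, prod_univ_erase_some] at key
  simp only [v, Option.elim_none, Option.elim_some, hP, Polynomial.eval_prod,
    Polynomial.eval_add, Polynomial.eval_X, Polynomial.eval_C] at key
  have e1 : (∏ j, (0 + t j)) / ∏ j, (0 - t j) = -1 := by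
    simp only [zero_add, zero_sub, prod_neg_sub_odd hN]
    have := Finset.prod_ne_zero_iff.2 fun i (_ : i ∈ Finset.univ) => h0 i
    field_simp
  have e5 : ∀ d, (∏ j, (t d + t j)) / ((t d - 0) *
      ∏ j ∈ Finset.univ.erase d, (t d - t j)) = 2 *
        ∏ j ∈ Finset.univ.erase d, (t d + t j) / (t d - t j) := fun d => by
    have := h0 d
    have : ∏ j ∈ Finset.univ.erase d, (t d - t j) ≠ 0 := Finset.prod_ne_zero_iff.2 fun j hj =>
      sub_ne_zero.2 fun h => (Finset.ne_of_mem_erase hj) (ht h).symm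
    rw [← Finset.mul_prod_erase _ _ (Finset.mem_univ d), Finset.prod_div_distrib, sub_zero]
    field_simp
    ring
  rw [e1, Finset.sum_congr rfl fun d _ => e5 d, ← Finset.mul_sum] at key
  have h2 : (2 : K) ≠ 0 := two_ne_zero
  refine mul_left_cancel₀ h2 ?_
  linear_combination -key

theorem sum_div_mul_prod_add_div_sub [CharZero K] {N : ℕ} (hN : Odd N) {t : Fin N → K}
    (ht : Function.Injective t) (h0 : ∀ i, t i ≠ 0) {s : K} (hs : ∀ i, t i + s ≠ 0) :
    ∑ d, (t d - s) / (t d + s) * ∏ j ∈ Finset.univ.erase d, (t d + t j) / (t d - t j) =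
      ∏ d, (t d - s) / (t d + s) := by
  rcases eq_or_ne s 0 with rfl | hs0
  · simp only [sub_zero, add_zero, div_self (h0 _), one_mul, Finset.prod_const_one]
    exact sum_prod_add_div_sub hN ht h0
  · exact sum_prod_add_div_sub_of_ne_zero hN ht h0 hs hs0

end PartialFractions

/-! ### Alternating products and Schur's Pfaffian. -/

section AltProd

variable {K : Type*} [Field K]

/-- The product `∏_{i < j} u i j`. -/
def ltProd {N : ℕ} (u : Fin N → Fin N → K) : K :=
  ∏ i, ∏ j, if i < j then u i j else 1

theorem ltProd_comp_perm {N : ℕ} {u : Fin N → Fin N → K} (hu : ∀ i j, u i j = -u j i)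
    (σ : Perm (Fin N)) :
    ltProd (fun i j => u (σ i) (σ j)) = ((sign σ : ℤ) : K) * ltProd u := by
  have h : ∀ v : Fin N → Fin N → K, ltProd v = ∏ i, ∏ j ∈ Finset.Ioi i, v i j := fun v =>
    Finset.prod_congr rfl fun i _ => by
      rw [← Finset.prod_filter]
      exact Finset.prod_congr (by ext; simp) fun _ _ => rfl
  rw [h, h]
  exact σ.prod_Ioi_comp_eq_sign_mul_prod hu

theorem ltProd_succ {N : ℕ} (u : Fin (N + 1) → Fin (N + 1) → K) :
    ltProd u = (∏ j : Fin N, u 0 j.succ) * ltProd fun i j : Fin N => u i.succ j.succ := by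
  simp [ltProd, Fin.prod_univ_succ]

theorem ltProd_castSucc {N : ℕ} (u : Fin (N + 1) → Fin (N + 1) → K) :
    ltProd u = (ltProd fun i j : Fin N => u i.castSucc j.castSucc) *
      ∏ i : Fin N, u i.castSucc (Fin.last N) := by
  simp [ltProd, Fin.prod_univ_castSucc, Fin.castSucc_lt_last, Finset.prod_mul_distrib,
    (Fin.le_last _).not_gt]

theorem ltProd_ne_zero {N : ℕ} {u : Fin N → Fin N → K} (hu : ∀ i j, i ≠ j → u i j ≠ 0) :
    ltProd u ≠ 0 :=
  Finset.prod_ne_zero_iff.2 fun i _ => Finset.prod_ne_zero_iff.2 fun j _ => by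
    split_ifs with h
    · exact hu i j h.ne
    · exact one_ne_zero

/-- Schur's Pfaffian. -/
theorem pfaffian_sub_div_add [CharZero K] {N : ℕ} (hN : Even N) {t : Fin N → K}
    (ht : Function.Injective t) (hadd : ∀ i j, i ≠ j → t i + t j ≠ 0)
    -- The last variable may vanish, as is needed for `Pf₀` with odd `n`.
    (h0 : ∀ i : Fin N, (i : ℕ) + 1 ≠ N → t i ≠ 0) :
    pfaffian (Matrix.of fun i j => (t i - t j) / (t i + t j)) =
      ltProd fun i j => (t i - t j) / (t i + t j) := by
  obtain ⟨k, hk⟩ := hN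
  induction k generalizing N with
  | zero =>
    obtain rfl : N = 0 := by omega
    simp [pfaffian, ltProd]
  | succ k ih =>
    obtain ⟨a, rfl⟩ : ∃ a, N = a + 2 := ⟨k + k, by omega⟩
    have ha : a = k + k := by omega
    have hu : ∀ x y : K, (x - y) / (x + y) = -((y - x) / (y + x)) := fun x y => by
      rw [add_comm y x, ← neg_div, neg_sub]
    set c : Fin (a + 1) → K := fun i => t i.castSucc with hc
    set s := t (Fin.last _) with hs
    have hcinj : Function.Injective c := ht.comp (Fin.castSucc_injective _)
    have hcadd : ∀ i j, i ≠ j → c i + c j ≠ 0 := fun i j hij =>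
      hadd _ _ fun h => hij (Fin.castSucc_injective _ h)
    have hc0 : ∀ i, c i ≠ 0 := fun i => h0 _ (by simp; omega)
    have hcs : ∀ i, c i + s ≠ 0 := fun i => hadd _ _ (Fin.castSucc_lt_last i).ne
    have hcu : ∀ i j, i ≠ j → (c i - c j) / (c i + c j) ≠ 0 := fun i j hij =>
      div_ne_zero (sub_ne_zero.2 fun h => hij (hcinj h)) (hcadd i j hij)
    rw [pfaffian_expand_col ⟨k, ha⟩ (fun i j => by exact hu _ _), ltProd_castSucc]
    simp only [Matrix.of_apply, ← hs]
    change _ = ltProd (fun i j => (c i - c j) / (c i + c j)) * ∏ i, (c i - s) / (c i + s)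
    rw [← sum_div_mul_prod_add_div_sub ⟨k, by omega⟩ hcinj hc0 hcs, Finset.mul_sum]
    refine Finset.sum_congr rfl fun d _ => ?_
    have hinj : Function.Injective fun i : Fin a => swap 0 d i.succ :=
      (swap 0 d).injective.comp (Fin.succ_injective _)
    have hih := ih (t := fun i : Fin a => c (swap 0 d i.succ)) (hcinj.comp hinj)
      (fun i j hij => hcadd _ _ fun h => hij (hinj h)) (fun i _ => hc0 _) ha
    -- Moving `d` to the front costs the sign of `swap 0 d`, and splitting off the front index shows
    -- that the product for the minor is, up to that sign, the full product divided by the factors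
    -- involving `d`. This turns the expansion into the partial fraction sum.
    have hperm := ltProd_comp_perm (u := fun i j => (c i - c j) / (c i + c j))
      (fun i j => hu _ _) (swap 0 d)
    rw [ltProd_succ] at hperm
    simp only [swap_apply_left] at hperm
    have hprod : ∏ j : Fin a, (c d - c (swap 0 d j.succ)) / (c d + c (swap 0 d j.succ)) =
        ∏ j ∈ Finset.univ.erase d, (c d - c j) / (c d + c j) := by
      refine Finset.prod_bij (fun j _ => swap 0 d j.succ) (fun j _ => ?_) (fun i _ j _ h => hinj h)
        (fun j hj => ?_) fun j _ => rfl
      · refine Finset.mem_erase.2 ⟨fun h => ?_, Finset.mem_univ _⟩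
        rw [Equiv.swap_apply_eq_iff, swap_apply_right] at h
        exact Fin.succ_ne_zero _ h
      · have : swap 0 d j ≠ 0 := fun h => by
          rw [Equiv.swap_apply_eq_iff, swap_apply_left] at h
          exact Finset.ne_of_mem_erase hj h
        obtain ⟨i, hi⟩ := Fin.exists_succ_eq.2 this
        exact ⟨i, Finset.mem_univ _, by rw [hi, swap_apply_self]⟩
    rw [hprod] at hperm
    have hne : ∏ j ∈ Finset.univ.erase d, (c d - c j) / (c d + c j) ≠ 0 :=
      Finset.prod_ne_zero_iff.2 fun j hj => hcu _ _ (Finset.ne_of_mem_erase hj).symm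
    have hinv : ∏ j ∈ Finset.univ.erase d, (c d + c j) / (c d - c j) =
        (∏ j ∈ Finset.univ.erase d, (c d - c j) / (c d + c j))⁻¹ := by
      rw [← Finset.prod_inv_distrib]
      exact Finset.prod_congr rfl fun j _ => (inv_div _ _).symm
    have hsgn : ((sign (swap 0 d) : ℤ) : K) = if d = 0 then 1 else -1 := by
      rw [sign_swap']
      by_cases h : d = 0
      · simp [h]
      · simp [h, Ne.symm h]
    rw [hsgn] at hperm
    refine (congrArg (fun z => (if d = 0 then 1 else -1) * ((c d - s) / (c d + s)) * z) hih).trans ?_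
    have hLt : ltProd (fun i j : Fin a => (c (swap 0 d i.succ) - c (swap 0 d j.succ)) /
        (c (swap 0 d i.succ) + c (swap 0 d j.succ))) = (if d = 0 then 1 else -1) *
        ltProd (fun i j => (c i - c j) / (c i + c j)) *
        (∏ j ∈ Finset.univ.erase d, (c d - c j) / (c d + c j))⁻¹ := by
      rw [← hperm]
      field_simp
    simp only [hLt, hinv]
    split_ifs <;> ring

end AltProd

/-! ### Transfer to `⊕`, the bordered Schur Pfaffian, and powers of `1 + β x`. -/

section Nimmo

variable {K : Type*} [Field K] [CharZero K]

theorem pfaffian_submatrix_cast {ι : Type*} {N N' : ℕ} (h : N = N') (M : Matrix ι ι K)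
    (v : Fin N → ι) (v' : Fin N' → ι) (hv : ∀ i, v i = v' (Fin.cast h i)) :
    pfaffian (M.submatrix v v) = pfaffian (M.submatrix v' v') := by
  subst h
  rw [show v = v' from funext hv]

theorem pfaffian_last_col_smul {a : ℕ} (ha : Even a) {A A' : Matrix (Fin (a + 2)) (Fin (a + 2)) K}
    (hA : ∀ i j, A i j = -A j i) (hA' : ∀ i j, A' i j = -A' j i) (c : K)
    (h : ∀ i j : Fin (a + 1), A i.castSucc j.castSucc = A' i.castSucc j.castSucc)
    (hl : ∀ i : Fin (a + 1), A i.castSucc (Fin.last _) = c * A' i.castSucc (Fin.last _)) :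
    pfaffian A = c * pfaffian A' := by
  rw [pfaffian_expand_col ha hA, pfaffian_expand_col ha hA', Finset.mul_sum]
  refine Finset.sum_congr rfl fun d _ => ?_
  rw [hl]
  have : A.submatrix (fun i : Fin a => (swap 0 d i.succ).castSucc)
      (fun i : Fin a => (swap 0 d i.succ).castSucc) =
      A'.submatrix (fun i : Fin a => (swap 0 d i.succ).castSucc)
      (fun i : Fin a => (swap 0 d i.succ).castSucc) := by
    ext i j
    exact h _ _
  rw [this]
  ring

variable {β : K}

omit [CharZero K] in
theorem oplus_comm (x y : K) : oplus β x y = oplus β y x := by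
  simp only [oplus]; ring

omit [CharZero K] in
theorem matA0_antisymm {n : ℕ} (x : Fin n → K) (i j : Fin n) :
    matA0 β x i j = -matA0 β x j i := by
  simp only [matA0, Matrix.of_apply]
  rw [oplus_comm (x j), ← neg_div, neg_sub]

omit [CharZero K] in
theorem div_two_add_add {x y : K} (hx : 2 + β * x ≠ 0) (hy : 2 + β * y ≠ 0) :
    x / (2 + β * x) + y / (2 + β * y) = 2 / ((2 + β * x) * (2 + β * y)) * oplus β x y := by
  rw [oplus, div_add_div _ _ hx hy, div_mul_eq_mul_div]
  congr 1
  ring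

/-- The substitution `x ↦ x / (2 + β x)` turns `(x - y) / (x ⊕ y)` into `(x - y) / (x + y)`. -/
theorem sub_div_oplus {x y : K} (hx : 2 + β * x ≠ 0) (hy : 2 + β * y ≠ 0) :
    (x - y) / oplus β x y =
      (x / (2 + β * x) - y / (2 + β * y)) / (x / (2 + β * x) + y / (2 + β * y)) := by
  have h1 : x / (2 + β * x) - y / (2 + β * y) =
      2 / ((2 + β * x) * (2 + β * y)) * (x - y) := by
    rw [div_sub_div _ _ hx hy, div_mul_eq_mul_div]
    congr 1
    ring
  rw [h1, div_two_add_add hx hy, mul_div_mul_left]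
  exact div_ne_zero two_ne_zero (mul_ne_zero hx hy)

theorem div_two_add_add_ne_zero {x y : K} (hx : 2 + β * x ≠ 0) (hy : 2 + β * y ≠ 0)
    (h : oplus β x y ≠ 0) : x / (2 + β * x) + y / (2 + β * y) ≠ 0 := by
  rw [div_two_add_add hx hy]
  exact mul_ne_zero (div_ne_zero two_ne_zero (mul_ne_zero hx hy)) h

theorem div_two_add_injective {n : ℕ} {x : Fin n → K} (hx : ∀ i, 2 + β * x i ≠ 0)
    (hinj : Function.Injective x) : Function.Injective fun i => x i / (2 + β * x i) := by
  intro i j h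
  have hi := hx i
  have hj := hx j
  have h' : x i * (2 + β * x j) = x j * (2 + β * x i) := (div_eq_div_iff hi hj).1 h
  refine hinj (mul_left_cancel₀ (two_ne_zero (α := K)) ?_)
  linear_combination h'

/-- Genericity of the variables. -/
structure Generic {n : ℕ} (β : K) (x : Fin n → K) : Prop where
  injective : Function.Injective x
  oplus_ne_zero : ∀ i j, i ≠ j → oplus β (x i) (x j) ≠ 0
  two_add_ne_zero : ∀ i, 2 + β * x i ≠ 0
  one_add_ne_zero : ∀ i, 1 + β * x i ≠ 0
  ne_zero : ∀ i, x i ≠ 0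

theorem pfaffian_matA0 {n : ℕ} (hn : Even n) {x : Fin n → K} (hinj : Function.Injective x)
    (hop : ∀ i j, i ≠ j → oplus β (x i) (x j) ≠ 0) (h2 : ∀ i, 2 + β * x i ≠ 0)
    (h0 : ∀ i : Fin n, (i : ℕ) + 1 ≠ n → x i ≠ 0) :
    pfaffian (matA0 β x) = ltProd (matA0 β x) := by
  have h := pfaffian_sub_div_add hn (div_two_add_injective h2 hinj)
    (fun i j hij => div_two_add_add_ne_zero (h2 i) (h2 j) (hop i j hij))
    (fun i hi => div_ne_zero (h0 i hi) (h2 i))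
  simp only [← sub_div_oplus (h2 _) (h2 _)] at h
  exact h

/-- For odd `n` the appended variable `0` contributes only factors `(x_i - 0)/(x_i ⊕ 0) = 1`. -/
theorem pf0_eq_ltProd {n : ℕ} {x : Fin n → K} (hx : Generic β x) :
    pf0 β x = ltProd (matA0 β x) := by
  rw [pf0]
  split_ifs with hn
  · exact pfaffian_matA0 hn hx.injective hx.oplus_ne_zero hx.two_add_ne_zero fun i _ => hx.ne_zero i
  · have hop0 : ∀ i, oplus β (x i) 0 = x i := fun i => by simp [oplus]
    rw [pfaffian_matA0 (Nat.not_even_iff_odd.1 hn).add_one]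
    · refine (ltProd_castSucc _).trans ?_
      simp [matA0, hop0, div_self (hx.ne_zero _)]
      rfl
    · rw [Fin.snoc_injective_iff]
      exact ⟨hx.injective, fun ⟨i, hi⟩ => hx.ne_zero i hi⟩
    · intro i j
      refine Fin.lastCases ?_ (fun i => ?_) i <;> refine Fin.lastCases ?_ (fun j => ?_) j
      · simp
      · simp [oplus_comm (0 : K) (x j), hop0, hx.ne_zero]
      · simp [hop0, hx.ne_zero]
      · intro hij
        simpa using hx.oplus_ne_zero i j fun h => hij (by rw [h])
    · intro i
      refine Fin.lastCases ?_ (fun i => ?_) i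
      · simp
      · simpa using hx.two_add_ne_zero i
    · intro i
      refine Fin.lastCases ?_ (fun i => ?_) i
      · simp
      · simpa using fun _ => hx.ne_zero i

omit [CharZero K] in
theorem Generic.comp {n q : ℕ} {x : Fin n → K} (hx : Generic β x) {f : Fin q → Fin n}
    (hf : Function.Injective f) : Generic β fun i => x (f i) :=
  ⟨hx.injective.comp hf, fun _ _ hij => hx.oplus_ne_zero _ _ fun h => hij (hf h),
    fun _ => hx.two_add_ne_zero _, fun _ => hx.one_add_ne_zero _, fun _ => hx.ne_zero _⟩

/-- The variant of Schur's Pfaffian with a border `1 / (1 + β x_i)`, which is, up to sign, the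
limit of `(x_i - y) / (x_i ⊕ y)` at `y = ∞`. -/
theorem pfaffian_matA0_border {a : ℕ} (ha : Even a) {x : Fin (a + 1) → K} (hx : Generic β x)
    (hβ : β ≠ 0) {A : Matrix (Fin (a + 2)) (Fin (a + 2)) K} (hA : ∀ i j, A i j = -A j i)
    (h : ∀ i j : Fin (a + 1), A i.castSucc j.castSucc = matA0 β x i j)
    (hl : ∀ i : Fin (a + 1), A i.castSucc (Fin.last _) = (1 + β * x i)⁻¹) :
    pfaffian A = ltProd (matA0 β x) * ∏ i, (1 + β * x i)⁻¹ := by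
  -- The node `β⁻¹` is the value of `y/(2 + β y)` at `y = ∞`; this is where `β ≠ 0` enters.
  set t : Fin (a + 2) → K := Fin.snoc (α := fun _ => K) (fun i => x i / (2 + β * x i)) β⁻¹ with ht
  have htc : ∀ i : Fin (a + 1), t i.castSucc = x i / (2 + β * x i) := fun i => by simp [ht]
  have htl : t (Fin.last _) = β⁻¹ := by simp [ht]
  have hs1 : ∀ i, x i / (2 + β * x i) + β⁻¹ =
      2 * (1 + β * x i) / (β * (2 + β * x i)) := fun i => by
    rw [inv_eq_one_div, div_add_div _ _ (hx.two_add_ne_zero i) hβ, mul_comm β (2 + _)]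
    congr 1
    ring
  have hs2 : ∀ i, x i / (2 + β * x i) - β⁻¹ = -(2 / (β * (2 + β * x i))) := fun i => by
    rw [inv_eq_one_div, div_sub_div _ _ (hx.two_add_ne_zero i) hβ, mul_comm β (2 + _), ← neg_div]
    congr 1
    ring
  have hs3 : ∀ i, x i / (2 + β * x i) + β⁻¹ ≠ 0 := fun i => by
    rw [hs1]
    exact div_ne_zero (mul_ne_zero two_ne_zero (hx.one_add_ne_zero i))
      (mul_ne_zero hβ (hx.two_add_ne_zero i))
  have hs4 : ∀ i, (x i / (2 + β * x i) - β⁻¹) / (x i / (2 + β * x i) + β⁻¹) =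
      -(1 + β * x i)⁻¹ := fun i => by
    have := hx.two_add_ne_zero i
    have := hx.one_add_ne_zero i
    rw [hs1, hs2]
    field_simp
  have htinj : Function.Injective t := by
    rw [ht, Fin.snoc_injective_iff]
    refine ⟨div_two_add_injective hx.two_add_ne_zero hx.injective, fun ⟨i, hi⟩ => ?_⟩
    have := hs2 i
    rw [sub_eq_zero.2 hi] at this
    exact div_ne_zero (two_ne_zero (α := K)) (mul_ne_zero hβ (hx.two_add_ne_zero i))
      (neg_eq_zero.1 this.symm)
  have hadd : ∀ i j, i ≠ j → t i + t j ≠ 0 := by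
    intro i j
    refine Fin.lastCases ?_ (fun i => ?_) i <;> refine Fin.lastCases ?_ (fun j => ?_) j
    · simp
    · intro _
      rw [htc, htl, add_comm]
      exact hs3 j
    · intro _
      rw [htc, htl]
      exact hs3 i
    · intro hij
      rw [htc, htc]
      exact div_two_add_add_ne_zero (hx.two_add_ne_zero i) (hx.two_add_ne_zero j)
        (hx.oplus_ne_zero i j fun h => hij (by rw [h]))
  have ht0 : ∀ i : Fin (a + 2), (i : ℕ) + 1 ≠ a + 2 → t i ≠ 0 := by
    intro i
    refine Fin.lastCases ?_ (fun i => ?_) i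
    · simp
    · intro _
      rw [htc]
      exact div_ne_zero (hx.ne_zero i) (hx.two_add_ne_zero i)
  have hS := pfaffian_sub_div_add (by exact ha.add even_two) htinj hadd ht0
  have hu : ∀ i j, (t i - t j) / (t i + t j) = -((t j - t i) / (t j + t i)) := fun i j => by
    rw [add_comm (t j), ← neg_div, neg_sub]
  rw [pfaffian_last_col_smul ha hA (A' := Matrix.of fun i j => (t i - t j) / (t i + t j)) hu (-1)
    (fun i j => ?_) (fun i => ?_), hS, ltProd_castSucc]
  · simp only [htc, htl, hs4, ← sub_div_oplus (hx.two_add_ne_zero _) (hx.two_add_ne_zero _)]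
    -- The `a + 1` border factors are each negated, an odd number of signs, which cancels the `-1`
    -- taken out of the last column.
    rw [prod_neg_sub_odd ha.add_one]
    change -1 * (ltProd (matA0 β x) * _) = _
    ring
  · simp only [Matrix.of_apply, htc]
    rw [h, ← sub_div_oplus (hx.two_add_ne_zero _) (hx.two_add_ne_zero _)]
    rfl
  · simp only [Matrix.of_apply, htc, htl]
    rw [hl, hs4]
    ring

omit [CharZero K] in
-- Index `j` is counted once for every `i < r` below it: `j` times if `j < r`, and `r` times
-- otherwise.
theorem prod_pow_eq_prod_prod_Ioi {r q : ℕ} (y : Fin (r + q) → K) :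
    ∏ i : Fin r, ∏ j ∈ Finset.Ioi (Fin.castAdd q i), y j =
      (∏ i : Fin r, y (Fin.castAdd q i) ^ (i : ℕ)) * ∏ j : Fin q, y (Fin.natAdd r j) ^ r := by
  have h : ∀ i : Fin r, ∏ j ∈ Finset.Ioi (Fin.castAdd q i), y j =
      ∏ j, if Fin.castAdd q i < j then y j else 1 := fun i => by
    rw [← Finset.prod_filter]
    exact Finset.prod_congr (by ext; simp) fun _ _ => rfl
  rw [Finset.prod_congr rfl fun i _ => h i, Finset.prod_comm, Fin.prod_univ_add]
  congr 1
  · refine Finset.prod_congr rfl fun j _ => ?_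
    rw [← Finset.prod_filter, Finset.prod_const]
    congr 1
    rw [show (Finset.univ.filter fun i : Fin r => Fin.castAdd q i < Fin.castAdd q j) =
      Finset.Iio j by ext; simp only [Finset.mem_filter, Finset.mem_univ, true_and,
        Finset.mem_Iio, Fin.lt_def, Fin.val_castAdd]]
    simp
  · refine Finset.prod_congr rfl fun j _ => ?_
    rw [← Finset.prod_filter, Finset.prod_const]
    congr 1
    rw [Finset.filter_true_of_mem fun i _ => by
      simp only [Fin.lt_def, Fin.val_castAdd, Fin.val_natAdd]; omega]
    simp

omit [CharZero K] in
-- With `z = 1 + β x` and `m = s + r`, the prefactor `z^m` against the column weight `z^(-(m - i))`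
-- leaves `z^i`, and against the border weight `z^(-s)` leaves `z^r`. These are the exponents with
-- which the denominators of `⊖` occur in the Hall-Littlewood sum.
theorem prod_weights {r q s : ℕ} {z : Fin (r + q) → K} (hz : ∀ i, z i ≠ 0)
    (w : Perm (Fin (r + q))) :
    (∏ i, z i ^ (s + r)) * ((∏ i : Fin r, z (w (Fin.castAdd q i)) ^ (-((s + r - i : ℤ)))) *
      ∏ j : Fin q, (z (w (Fin.natAdd r j)) ^ s)⁻¹) =
      ∏ i : Fin r, ∏ j ∈ Finset.Ioi (Fin.castAdd q i), z (w j) := by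
  rw [prod_pow_eq_prod_prod_Ioi fun j => z (w j), ← Equiv.prod_comp w, Fin.prod_univ_add,
    mul_mul_mul_comm, ← Finset.prod_mul_distrib, ← Finset.prod_mul_distrib]
  congr 1
  · refine Finset.prod_congr rfl fun i _ => ?_
    rw [← zpow_natCast, ← zpow_add₀ (hz _), ← zpow_natCast]
    congr 1
    push_cast
    ring
  · refine Finset.prod_congr rfl fun j _ => ?_
    rw [pow_add, mul_comm (_ ^ s), mul_assoc, mul_inv_cancel₀ (pow_ne_zero _ (hz _)), mul_one]

omit [CharZero K] in
theorem ltProd_add {r q : ℕ} (u : Fin (r + q) → Fin (r + q) → K) :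
    ltProd u = (∏ i : Fin r, ∏ j ∈ Finset.Ioi (Fin.castAdd q i), u (Fin.castAdd q i) j) *
      ltProd fun i j : Fin q => u (Fin.natAdd r i) (Fin.natAdd r j) := by
  rw [ltProd, Fin.prod_univ_add]
  congr 1
  · refine Finset.prod_congr rfl fun i _ => ?_
    rw [← Finset.prod_filter]
    exact Finset.prod_congr (by ext; simp) fun _ _ => rfl
  · refine Finset.prod_congr rfl fun i _ => ?_
    rw [Fin.prod_univ_add, Finset.prod_eq_one, one_mul]
    · simp
    · intro j _
      rw [if_neg]
      simp only [Fin.lt_def, Fin.val_natAdd, Fin.val_castAdd]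
      omega

omit [CharZero K] in
-- Each quotient `(x ⊕ y)/(x ⊖ y)` equals `(1 + β y)` divided by the entry `(x - y)/(x ⊕ y)`, so it
-- cancels the matching factor of the alternating product taken in the order `w`.
theorem prod_oplus_div_ominus_mul_ltProd {r q : ℕ} {x : Fin (r + q) → K} (hx : Generic β x)
    (w : Perm (Fin (r + q))) :
    (∏ i : Fin r, ∏ j ∈ Finset.Ioi (Fin.castAdd q i),
      oplus β (x (w (Fin.castAdd q i))) (x (w j)) / ominus β (x (w (Fin.castAdd q i))) (x (w j))) *
        ltProd (matA0 β x) = ((sign w : ℤ) : K) *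
      ((∏ i : Fin r, ∏ j ∈ Finset.Ioi (Fin.castAdd q i), (1 + β * x (w j))) *
        ltProd (matA0 β fun j : Fin q => x (w (Fin.natAdd r j)))) := by
  have h1 := ltProd_comp_perm (matA0_antisymm (β := β) x) w
  have h2 : ltProd (matA0 β x) = ((sign w : ℤ) : K) *
      ltProd fun i j => matA0 β x (w i) (w j) := by
    rw [h1, ← mul_assoc]
    rcases Int.units_eq_one_or (sign w) with h | h <;> simp [h]
  rw [h2, ltProd_add, mul_left_comm, ← mul_assoc (∏ i : Fin r, _), ← Finset.prod_mul_distrib]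
  congr 2
  refine Finset.prod_congr rfl fun i _ => ?_
  rw [← Finset.prod_mul_distrib]
  refine Finset.prod_congr rfl fun j hj => ?_
  have hij : w (Fin.castAdd q i) ≠ w j := fun h => (Finset.mem_Ioi.1 hj).ne (w.injective h)
  have h3 := hx.oplus_ne_zero _ _ hij
  have h4 : x (w (Fin.castAdd q i)) - x (w j) ≠ 0 := sub_ne_zero.2 fun h => hij (hx.injective h)
  have h5 := hx.one_add_ne_zero (w j)
  simp only [matA0, Matrix.of_apply, ominus]
  field_simp

end Nimmo

/-! ### Comparison of the two signed sums for generic variables. -/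

section Main

variable {K : Type*} [Field K] [CharZero K] {β : K}

theorem hallLittlewoodSum_mul_ltProd (p : K → ℕ → K) {n q : ℕ} {x : Fin n → K}
    (hx : Generic β x) (lam : StrictPartition) (hr : lam.length ≤ n) (hn : n = lam.length + q)
    (s : ℕ) :
    hallLittlewoodSum β p x lam hr * ltProd (matA0 β x) =
      (∏ i, (1 + β * x i) ^ (s + lam.length)) * ((q.factorial : K)⁻¹ *
        ∑ w : Perm (Fin n), ((sign w : ℤ) : K) *
          ((∏ i : Fin lam.length, p (x (w ⟨i, by omega⟩)) (lam.parts i) *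
              (1 + β * x (w ⟨i, by omega⟩)) ^ (-(s + lam.length - i : ℤ))) *
            (ltProd (matA0 β fun j : Fin q => x (w ⟨lam.length + j, by omega⟩)) *
              ∏ j : Fin q, ((1 + β * x (w ⟨lam.length + j, by omega⟩)) ^ s)⁻¹))) := by
  subst hn
  rw [hallLittlewoodSum, Nat.add_sub_cancel_left, mul_assoc, mul_left_comm (∏ i, _)]
  congr 1
  rw [Finset.sum_mul, Finset.mul_sum]
  refine Finset.sum_congr rfl fun w _ => ?_
  have h1 := prod_oplus_div_ominus_mul_ltProd hx w
  have h2 := prod_weights (r := lam.length) (s := s) hx.one_add_ne_zero w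
  rw [← h2] at h1
  rw [mul_assoc]
  refine (congrArg (fun z => (∏ i : Fin lam.length, p (x (w (Fin.castLE hr i))) (lam.parts i)) * z)
    h1).trans ?_
  rw [Finset.prod_mul_distrib]
  change _ = _ * (_ * (((∏ i : Fin lam.length, p (x (w (Fin.castLE hr i))) (lam.parts i)) *
    ∏ i : Fin lam.length, (1 + β * x (w (Fin.castAdd q i))) ^ (-(s + lam.length - i : ℤ))) *
    (ltProd (matA0 β fun j : Fin q => x (w (Fin.natAdd lam.length j))) *
      ∏ j : Fin q, ((1 + β * x (w (Fin.natAdd lam.length j))) ^ s)⁻¹)))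
  ring

omit [CharZero K] in
theorem fromBlocks_antisymm {n m : ℕ} (x : Fin n → K) (B : Matrix (Fin n) (Fin m) K)
    (i j : Fin n ⊕ Fin m) :
    Matrix.fromBlocks (matA0 β x) B (-B.transpose) 0 i j =
      -Matrix.fromBlocks (matA0 β x) B (-B.transpose) 0 j i := by
  rcases i with i | i <;> rcases j with j | j <;> simp [← matA0_antisymm x]

/-- The Pfaffian of `A₀(y)`, bordered by `s ≤ 1` columns with entries `1 / (1 + β y_i)`. -/
theorem pfaffian_append_border {n q s m : ℕ} {x : Fin n → K} (hx : Generic β x) (hβ : β ≠ 0)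
    (hs : s ≤ 1) (hq : Even (q + s)) {B : Matrix (Fin n) (Fin m) K} (c : Fin s → Fin m)
    (hB : ∀ i j, B i (c j) = (1 + β * x i)⁻¹) {v : Fin q → Fin n} (hv : Function.Injective v) :
    pfaffian ((Matrix.fromBlocks (matA0 β x) B (-B.transpose) 0).submatrix
      (Fin.append (fun j => Sum.inl (v j)) fun j => Sum.inr (c j))
      (Fin.append (fun j => Sum.inl (v j)) fun j => Sum.inr (c j))) =
      ltProd (matA0 β fun j => x (v j)) * ∏ j, ((1 + β * x (v j)) ^ s)⁻¹ := by
  have hy := hx.comp hv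
  obtain rfl | rfl : s = 0 ∨ s = 1 := by omega
  · rw [pfaffian_submatrix_cast (N' := q) rfl _ _ (fun j => Sum.inl (v j)) fun i =>
      Fin.append_left _ _ i]
    simp only [pow_zero, inv_one, Finset.prod_const_one, mul_one]
    rw [← pfaffian_matA0 (by simpa using hq) hy.injective hy.oplus_ne_zero hy.two_add_ne_zero
      fun i _ => hy.ne_zero i]
    rfl
  · obtain ⟨a, rfl⟩ : ∃ a, q = a + 1 := by
      obtain ⟨k, hk⟩ := hq
      exact ⟨q - 1, by omega⟩
    have ha : Even a := by
      obtain ⟨k, hk⟩ := hq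
      exact ⟨k - 1, by omega⟩
    have hc : ∀ i : Fin (a + 1), (Fin.append (fun j => (Sum.inl (v j) : Fin n ⊕ Fin m))
        fun j : Fin 1 => Sum.inr (c j)) i.castSucc = Sum.inl (v i) := fun i =>
      Fin.append_left _ _ i
    have hl : (Fin.append (fun j => (Sum.inl (v j) : Fin n ⊕ Fin m))
        fun j : Fin 1 => Sum.inr (c j)) (Fin.last (a + 1)) = Sum.inr (c 0) :=
      Fin.append_right _ _ (0 : Fin 1)
    simp only [pow_one]
    refine pfaffian_matA0_border ha hy hβ (fun i j => fromBlocks_antisymm _ _ _ _)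
      (fun i j => ?_) fun i => ?_
    · rw [Matrix.submatrix_apply, hc, hc]
      rfl
    · rw [Matrix.submatrix_apply, hc, hl, Matrix.fromBlocks_apply₁₂, hB]

theorem factorial_mul_pfaffian_fromBlocks {p : K → ℕ → K} (hp : ∀ y, p y 0 = 1) {n q s m : ℕ}
    {x : Fin n → K} (hx : Generic β x) (hβ : β ≠ 0) (lam : StrictPartition)
    (hn : n = lam.length + q) (hs : s ≤ 1) (hq : Even (q + s))
    (hm : m = s + lam.length) :
    (q.factorial : K) * pfaffian ((Matrix.fromBlocks (matA0 β x) (matB β p x lam m)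
        (-(matB β p x lam m).transpose) 0).submatrix finSumFinEquiv.symm finSumFinEquiv.symm) =
        ∑ w : Perm (Fin n), ((sign w : ℤ) : K) *
          ((∏ i : Fin lam.length, p (x (w ⟨i, by omega⟩)) (lam.parts i) *
              (1 + β * x (w ⟨i, by omega⟩)) ^ (-(s + lam.length - i : ℤ))) *
            (ltProd (matA0 β fun j : Fin q => x (w ⟨lam.length + j, by omega⟩)) *
              ∏ j : Fin q, ((1 + β * x (w ⟨lam.length + j, by omega⟩)) ^ s)⁻¹)) := by
  subst hm
  set B := matB β p x lam (s + lam.length) with hB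
  set g : Fin s → Fin n ⊕ Fin (s + lam.length) := fun j => Sum.inr (Fin.castAdd _ j) with hg
  set f : Fin lam.length → Fin n ⊕ Fin (s + lam.length) := fun j => Sum.inr (Fin.natAdd _ j) with hf
  -- When `s = 1` the first column of `B` belongs to `λ_{r+1} = 0`, where `p` is `1` and the weight
  -- has exponent `-1`: it is the border column.
  have hBg : ∀ i (j : Fin s), B i (Fin.castAdd _ j) = (1 + β * x i)⁻¹ := fun i j => by
    have hj := j.isLt
    have hj0 : (j : ℕ) = 0 := by omega
    simp only [hB, matB, Matrix.of_apply, Fin.val_rev, Fin.val_castAdd, hj0]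
    rw [StrictPartition.part, dif_neg (by omega), hp, one_mul]
    simp
  -- The columns of `B` list the parts in reverse, which undoes the reversal in the iterated
  -- expansion.
  have hBf : ∀ i (j : Fin lam.length), B i (Fin.natAdd s j.rev) = p (x i) (lam.parts j) *
      (1 + β * x i) ^ (-(s + lam.length - j : ℤ)) := fun i j => by
    have hj := j.isLt
    have h1 : s + lam.length - (s + (lam.length - (j + 1)) + 1) = (j : ℕ) := by omega
    simp only [hB, matB, Matrix.of_apply, Fin.val_rev, Fin.val_natAdd, h1]
    rw [StrictPartition.part, dif_pos hj]
    congr 2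
    push_cast [Nat.cast_sub (show (j : ℕ) + 1 ≤ lam.length from hj)]
    ring
  rw [pfaffian_submatrix_cast (add_assoc n s lam.length).symm _ _
    (Fin.append (Fin.append (fun i => Sum.inl i) g) f) fun i => ?_]
  · rw [factorial_mul_pfaffian_append (fromBlocks_antisymm x B) g hn hq _ f (fun _ _ => rfl)
      (fun _ _ => rfl)]
    refine Finset.sum_congr rfl fun w _ => ?_
    rw [pfaffian_append_border hx hβ hs hq (Fin.castAdd lam.length) hBg
      (v := fun j : Fin q => w ⟨lam.length + j, by omega⟩)
      fun i j h => by simpa [Fin.ext_iff] using h]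
    simp only [hf, Matrix.fromBlocks_apply₁₂, hBf]
  · refine Fin.addCases (fun i => ?_) (fun i => ?_) i
    · rw [finSumFinEquiv_symm_apply_castAdd]
      exact ((Fin.append_left _ _ (Fin.castAdd s i)).trans (Fin.append_left _ _ i)).symm
    · rw [finSumFinEquiv_symm_apply_natAdd]
      refine Fin.addCases (fun i => ?_) (fun i => ?_) i
      · have : Fin.cast (add_assoc n s lam.length).symm (Fin.natAdd n (Fin.castAdd lam.length i)) =
            Fin.castAdd lam.length (Fin.natAdd n i) := Fin.ext (by simp)
        rw [this, Fin.append_left, Fin.append_right]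
      · have : Fin.cast (add_assoc n s lam.length).symm (Fin.natAdd n (Fin.natAdd s i)) =
            Fin.natAdd (n + s) i := Fin.ext (by simp; omega)
        rw [this, Fin.append_right]

/-- The Nimmo type formula for generic values of the variables. -/
theorem hallLittlewoodSum_eq_pfaffian_div {p : K → ℕ → K} (hp : ∀ y, p y 0 = 1) {n : ℕ}
    {x : Fin n → K} (hx : Generic β x) (hβ : β ≠ 0) (lam : StrictPartition)
    (hr : lam.length ≤ n) :
    hallLittlewoodSum β p x lam hr = (∏ i, (1 + β * x i) ^ nimmoSize n lam.length) *
      (pfaffian (matA β p x lam) / pf0 β x) := by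
  obtain ⟨q, hn⟩ := Nat.exists_eq_add_of_le hr
  -- Here `s = m - r` is the number of border columns, chosen so that `(n - r) + s` is even.
  obtain ⟨s, hs, hq, hm⟩ : ∃ s, s ≤ 1 ∧ Even (q + s) ∧
      nimmoSize n lam.length = s + lam.length := by
    rw [nimmoSize, show n - lam.length = q by omega]
    split_ifs with h
    · exact ⟨0, by omega, h, by omega⟩
    · exact ⟨1, le_rfl, (Nat.not_even_iff_odd.1 h).add_one, by omega⟩
  have hD : ltProd (matA0 β x) ≠ 0 := ltProd_ne_zero fun i j hij =>
    div_ne_zero (sub_ne_zero.2 fun h => hij (hx.injective h)) (hx.oplus_ne_zero i j hij)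
  rw [pf0_eq_ltProd hx, ← mul_div_assoc, eq_div_iff hD,
    hallLittlewoodSum_mul_ltProd p hx lam hr hn s,
    ← factorial_mul_pfaffian_fromBlocks hp hx hβ lam hn hs hq hm,
    inv_mul_cancel_left₀ (Nat.cast_ne_zero.2 q.factorial_ne_zero), matA]
  simp only [hm]

end Main

/-! ### Genericity of the indeterminates. -/

/-- A polynomial with a nonzero integer value is nonzero, and the polynomial ring embeds in its
fraction field. Every genericity condition is thus checked at `β = 1`, `x_i = i`. -/
theorem algebraMap_ratFun_ne_zero {n : ℕ} {P : MvPolynomial (Var n) ℤ} (v : Var n → ℤ)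
    (h : MvPolynomial.eval v P ≠ 0) :
    algebraMap (MvPolynomial (Var n) ℤ) (RatFun n) P ≠ 0 := by
  rw [Ne, FaithfulSMul.algebraMap_eq_zero_iff]
  rintro rfl
  exact h (map_zero _)

/-- A specialisation of the indeterminates to positive integers, injective on the `x_i`. -/
def Var.value {n : ℕ} : Var n → ℤ
  | .x i => (i : ℤ) + 1
  | _ => 1

theorem generic_ind (n : ℕ) :
    Generic (ind (Var.beta : Var n)) fun i : Fin n => ind (Var.x i) where
  injective i j h := by
    by_contra hij
    refine algebraMap_ratFun_ne_zero (n := n)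
      (P := MvPolynomial.X (Var.x i) - MvPolynomial.X (Var.x j)) Var.value ?_ ?_
    · simpa [Var.value, sub_eq_zero, Fin.ext_iff] using hij
    · rw [map_sub, sub_eq_zero]
      exact h
  oplus_ne_zero i j _ := by
    have h := algebraMap_ratFun_ne_zero (n := n)
      (P := MvPolynomial.X (Var.x i) + MvPolynomial.X (Var.x j) +
        MvPolynomial.X Var.beta * MvPolynomial.X (Var.x i) * MvPolynomial.X (Var.x j)) Var.value (by
        simp only [map_add, map_mul, MvPolynomial.eval_X, Var.value]
        positivity)
    simp only [map_add, map_mul] at h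
    exact h
  two_add_ne_zero i := by
    have h := algebraMap_ratFun_ne_zero (n := n)
      (P := 2 + MvPolynomial.X Var.beta * MvPolynomial.X (Var.x i)) Var.value (by
        simp only [map_add, map_mul, MvPolynomial.eval_X, Var.value, map_ofNat]
        positivity)
    simp only [map_add, map_mul, map_ofNat] at h
    exact h
  one_add_ne_zero i := by
    have h := algebraMap_ratFun_ne_zero (n := n)
      (P := 1 + MvPolynomial.X Var.beta * MvPolynomial.X (Var.x i)) Var.value (by
        simp only [map_add, map_mul, MvPolynomial.eval_X, Var.value, map_one]
        positivity)
    simp only [map_add, map_mul, map_one] at h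
    exact h
  ne_zero i := algebraMap_ratFun_ne_zero Var.value (by
    simp only [MvPolynomial.eval_X, Var.value]
    positivity)

end KTheoretic

theorem mainTheorem5 (n : ℕ) (lam : StrictPartition) (hr : lam.length ≤ n)
    (β : KTheoretic.RatFun n) (b : ℕ → KTheoretic.RatFun n) (x : Fin n → KTheoretic.RatFun n)
    (hβ : β = KTheoretic.ind KTheoretic.Var.beta)
    (hb : ∀ i, b i = KTheoretic.ind (KTheoretic.Var.b i))
    (hx : ∀ i, x i = KTheoretic.ind (KTheoretic.Var.x i)) :
    KTheoretic.pf0 β x ≠ 0 ∧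
    KTheoretic.GQ β b x lam hr =
      (∏ i, (1 + β * x i) ^ KTheoretic.nimmoSize n lam.length) *
        (KTheoretic.pfaffian (KTheoretic.matA β (KTheoretic.dblFacPow β b) x lam) /
          KTheoretic.pf0 β x) ∧
    KTheoretic.GP β b x lam hr =
      (∏ i, (1 + β * x i) ^ KTheoretic.nimmoSize n lam.length) *
        (KTheoretic.pfaffian (KTheoretic.matA β (KTheoretic.facPow β b) x lam) /
          KTheoretic.pf0 β x) := by
  have hgen : KTheoretic.Generic β x := by
    rw [hβ, show x = _ from funext hx]
    exact KTheoretic.generic_ind n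
  have hβ0 : β ≠ 0 := by
    rw [hβ]
    exact KTheoretic.algebraMap_ratFun_ne_zero KTheoretic.Var.value
      (by simp [KTheoretic.Var.value])
  refine ⟨?_, KTheoretic.hallLittlewoodSum_eq_pfaffian_div (fun _ => rfl) hgen hβ0 lam hr,
    KTheoretic.hallLittlewoodSum_eq_pfaffian_div (fun _ => rfl) hgen hβ0 lam hr⟩
  rw [KTheoretic.pf0_eq_ltProd hgen]
  exact KTheoretic.ltProd_ne_zero fun i j hij => div_ne_zero
    (sub_ne_zero.2 fun h => hij (hgen.injective h)) (hgen.oplus_ne_zero i j hij)
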